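/- For a graph $G$ let $\mathrm{ch}(G)$ be the least cardinal $\chi$ such that $G$ has a proper vertex colouring with $\chi$ colours. For cardinals $\lambda,\kappa$, $\mathrm{INC}_{\mathrm{chr}}(\lambda,\kappa)$ says: there is a graph $G$ with $\lambda$ nodes and $\mathrm{ch}(G)\ge\kappa^+$ such that every subgraph of $G$ with fewer than $\lambda$ nodes has chromatic number $<\kappa^+$. Let $\kappa<\lambda$ be (infinite) regular cardinals with $\lambda=\lambda^\kappa$, and let $S\subseteq S^\lambda_\kappa=\{\delta<\lambda:\mathrm{cf}(\delta)=\kappa\}$ be a stationary subset of $\lambda$ that does not reflect, i.e. for no ordinal $\delta<\lambda$ of uncountable cofinality is $S\cap\delta$ stationary in $\delta$. Then there is a graph $G$ with $\lambda$ nodes and $\mathrm{ch}(G)>\kappa$ such that every subgraph of $G$ with fewer than $\lambda$ nodes has chromatic number $\le\kappa$. In other words, $\mathrm{INC}_{\mathrm{chr}}(\lambda,\kappa)$ holds. -/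

import Mathlib

open Cardinal Ordinal

universe u

/-- The chromatic number of a graph as a cardinal: the least `χ` such that the graph has a proper
colouring with values in a set of cardinality at most `χ`. (Mathlib's
`SimpleGraph.chromaticNumber` takes values in `ℕ∞` and does not separate infinite cardinals.) -/
noncomputable def SimpleGraph.chromaticCard {V : Type u} (G : SimpleGraph V) : Cardinal.{u} :=
  sInf {χ : Cardinal.{u} | ∃ C : Type u, #C ≤ χ ∧ Nonempty (G.Coloring C)}

/-- The infimum in `SimpleGraph.chromaticCard` is attained: the chromatic number is at most `χ`
iff there is a proper colouring with at most `χ` colours. -/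
theorem SimpleGraph.chromaticCard_le_iff {V : Type u} (G : SimpleGraph V) (χ : Cardinal.{u}) :
    G.chromaticCard ≤ χ ↔ ∃ C : Type u, #C ≤ χ ∧ Nonempty (G.Coloring C) := by
  constructor
  · intro h
    have hne : {χ : Cardinal.{u} | ∃ C : Type u, #C ≤ χ ∧ Nonempty (G.Coloring C)}.Nonempty :=
      ⟨#V, V, le_rfl, ⟨G.selfColoring⟩⟩
    obtain ⟨C, hC, hG⟩ := csInf_mem hne
    exact ⟨C, hC.trans h, hG⟩
  · intro h
    exact csInf_le' h

/-- `INCchrLT lam χ`: there is a graph with `lam` nodes and chromatic number at least `χ`, every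
subgraph of which with fewer than `lam` nodes has chromatic number less than `χ`. -/
def INCchrLT (lam χ : Cardinal.{u}) : Prop :=
  ∃ (V : Type u) (G : SimpleGraph V), #V = lam ∧ χ ≤ G.chromaticCard ∧
    ∀ H : G.Subgraph, #H.verts < lam → H.coe.chromaticCard < χ

/-- `INCchr lam κ` is `INCchrLT lam χ` for `χ` the successor cardinal of `κ`. -/
def INCchr (lam κ : Cardinal.{u}) : Prop :=
  INCchrLT lam (Order.succ κ)

/-- `cofSet lam κ` is the set of ordinals below (the initial ordinal of) `lam` that have
cofinality `κ`. -/
def cofSet (lam κ : Cardinal.{u}) : Set Ordinal.{u} :=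
  {δ | δ < lam.ord ∧ δ.cof = κ}

/-- `S ∩ δ` is stationary in the ordinal `δ`: it meets every closed unbounded subset of `δ`. -/
def StationaryIn (S : Set Ordinal.{u}) (δ : Ordinal.{u}) : Prop :=
  IsStationary {x : Set.Iio δ | (x : Ordinal.{u}) ∈ S}

/-- `S` reflects below `lam`: `S ∩ δ` is stationary in `δ` for some ordinal `δ < lam` of
uncountable cofinality. -/
def Reflects (S : Set Ordinal.{u}) (lam : Cardinal.{u}) : Prop :=
  ∃ δ < lam.ord, ℵ₀ < δ.cof ∧ StationaryIn S δ

/-!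
The nodes of the graph are arranged on levels `δ < lam`, with `lam` nodes on each level. A node on a
level `δ ∈ S` may be joined to the members of its *ladder*, a sequence of `κ` nodes on lower levels that
climbs to `δ`; the remaining nodes have an empty ladder. Since `lam ^ κ = lam`, all sequences climbing
to `δ` can be used as ladders on level `δ` (`exists_isLadderSystem`).

The graph is not `κ`-colourable because `S` is stationary: in a colouring with `κ` colours, there is
a level `δ ∈ S` such that each colour used on level `δ` is used cofinally often below `δ`. As
`cf δ = κ`, some ladder climbing to `δ` meets all these colours, and the node on level `δ` with that
ladder has the same colour as one of its neighbours (`IsLadderSystem.lt_chromaticCard`).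

A subgraph with fewer than `lam` nodes is contained in the levels below some `γ < lam`, because
`lam` is regular. These levels are coloured by induction on `γ`, with the statement strengthened to
intervals `[α, γ)` with `α ∉ S`, arbitrary palettes of size `κ`, and fewer than `κ` forbidden colours
at each node. Limit steps use a club in `γ` that avoids `S`, which exists because `S` does not
reflect and, in cofinality `ω`, because `S` has only limit ordinals as members; a node on level `δ > e`, with `e` in the club, or on level `e` itself, has fewer than `κ`
neighbours below `e`, so colourings of successive blocks can be glued
(`IsLadderSystem.exists_isListColoring`).
-/

section Incompactness

open Set Order

/-! ### Closed unbounded sets -/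

/-- The closure points of a function on a regular uncountable well-order form a club; regularity
enters through `hIic`, by which the values of `g` on an initial segment are bounded. -/
theorem isClub_setOf_forall_lt_map_lt {α : Type*} [LinearOrder α] [WellFoundedLT α]
    (hα : ℵ₀ < Order.cof α) (hIic : ∀ a : α, #(Iic a) < Order.cof α) (g : α → α) :
    IsClub {x | ∀ y < x, g y < x} := by
  constructor
  · intro d hd _ _ a ha y hy
    obtain ⟨b, hb, hyb⟩ := (lt_isLUB_iff ha).1 hy
    exact (hd hb y hyb).trans_le (ha.1 hb)
  · intro a
    have hstep : ∀ b : α, ∃ z, b < z ∧ ∀ y ≤ b, g y < z := by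
      intro b
      have h1 : ¬ IsCofinal (insert b (g '' Iic b)) := by
        intro h
        have h2 : #(insert b (g '' Iic b) : Set α) < Order.cof α :=
          mk_insert_le.trans_lt (add_lt_of_lt hα.le (mk_image_le.trans_lt (hIic b))
            (one_lt_aleph0.trans hα))
        exact (cof_le h).not_gt h2
      obtain ⟨z, hz⟩ := not_isCofinal_iff.1 h1
      refine ⟨z, ?_, fun y hy => ?_⟩
      · exact hz _ (mem_insert _ _)
      · exact hz _ (mem_insert_of_mem _ ⟨y, hy, rfl⟩)
    choose f hf hf' using hstep
    have h1 : ¬ IsCofinal (range fun n : ℕ => f^[n] a) := by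
      intro h
      refine (cof_le h).not_gt (lt_of_le_of_lt ?_ hα)
      simpa using mk_range_le_lift (f := fun n : ℕ => f^[n] a)
    obtain ⟨z, hz⟩ := not_isCofinal_iff.1 h1
    have hne : (upperBounds (range fun n : ℕ => f^[n] a)).Nonempty :=
      ⟨z, fun x hx => (hz x hx).le⟩
    obtain ⟨x, hx, hmin⟩ := WellFounded.has_min (wellFounded_lt (α := α)) _ hne
    refine ⟨x, fun y hy => ?_, hx ⟨0, rfl⟩⟩
    have : y ∉ upperBounds (range fun n : ℕ => f^[n] a) := fun h => hmin y h hy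
    simp only [mem_upperBounds, mem_range, forall_exists_index, forall_apply_eq_imp_iff,
      not_forall, not_le] at this
    obtain ⟨n, hn⟩ := this
    refine (hf' _ y hn.le).trans_le (hx ⟨n + 1, ?_⟩)
    simp only [Function.iterate_succ_apply']

theorem mk_Iio_toType_lt {κ : Cardinal.{u}} (i : κ.ord.ToType) : #(Iio i) < κ := by
  simpa using mk_Iio_lt i (by simp)

theorem exists_strictMono_cofinal {δ : Ordinal.{u}} {κ : Cardinal.{u}} (hδ : δ.cof = κ) :
    ∃ d : κ.ord.ToType → Ordinal.{u}, StrictMono d ∧ (∀ i, d i < δ) ∧ ∀ y < δ, ∃ i, y ≤ d i := by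
  subst hδ
  obtain ⟨f, hf⟩ := exists_isFundamentalSeq (o := δ) rfl
  refine ⟨fun i => f (ToType.toOrd i), ?_, fun i => (f _).2, fun y hy => ?_⟩
  · exact fun i j hij => hf.strictMono (ToType.mk.symm.strictMono hij)
  · obtain ⟨_, ⟨i, rfl⟩, hi⟩ := hf.isCofinal_range ⟨y, hy⟩
    refine ⟨ToType.mk i, ?_⟩
    change y ≤ f (ToType.mk.symm (ToType.mk i))
    rw [OrderIso.symm_apply_apply]
    exact hi

/-- Under nonreflection, a limit ordinal contains a closed unbounded set that avoids `S`. In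
cofinality `ω` any sequence of successor ordinals will do, since `S` consists of limit ordinals. -/
theorem exists_club_disjoint {S : Set Ordinal.{u}} {γ : Ordinal.{u}} (hγ : IsSuccLimit γ)
    (hS : ∀ x ∈ S, IsSuccLimit x) (hstat : ℵ₀ < γ.cof → ¬ StationaryIn S γ) :
    ∃ E : Set Ordinal.{u}, (∀ x ∈ E, x < γ) ∧ (∀ x ∈ E, x ∉ S) ∧ (∀ y < γ, ∃ x ∈ E, y ≤ x) ∧
      ∀ T ⊆ E, T.Nonempty → sSup T < γ → sSup T ∈ E := by
  have hcof : ℵ₀ ≤ γ.cof := aleph0_le_cof_iff.2 (one_lt_cof_iff.2 hγ)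
  obtain hω | hω := hcof.eq_or_lt
  · obtain ⟨d, hd, hdlt, hdcof⟩ := exists_strictMono_cofinal hω.symm
    refine ⟨range fun i => d i + 1, ?_, ?_, ?_, ?_⟩
    · rintro _ ⟨i, rfl⟩
      exact hγ.add_one_lt (hdlt i)
    · rintro _ ⟨i, rfl⟩ h
      exact not_isSuccLimit_add_one _ (hS _ h)
    · intro y hy
      obtain ⟨i, hi⟩ := hdcof y hy
      exact ⟨_, ⟨i, rfl⟩, hi.trans (lt_add_one _).le⟩
    · intro T hT hne hlt
      have hbdd : BddAbove T := ⟨γ, fun x hx => by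
        obtain ⟨i, rfl⟩ := hT hx
        exact (hγ.add_one_lt (hdlt i)).le⟩
      -- a bounded subset of a sequence of type `ω` is finite
      obtain ⟨i₀, hi₀⟩ := hdcof _ hlt
      have hfin : T.Finite := by
        have h1 : (Iio i₀).Finite := by
          rw [← lt_aleph0_iff_set_finite]
          exact mk_Iio_toType_lt i₀
        refine (h1.image fun i => d i + 1).subset fun x hx => ?_
        obtain ⟨i, rfl⟩ := hT hx
        refine ⟨i, hd.lt_iff_lt.1 ?_, rfl⟩
        exact (lt_add_one _).trans_le ((le_csSup hbdd hx).trans hi₀)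
      exact hT (hne.csSup_mem hfin)
  · have h := hstat hω
    rw [StationaryIn, not_isStationary_iff] at h
    obtain ⟨t, ht, hdisj⟩ := h
    refine ⟨Subtype.val '' t, ?_, ?_, ?_, ?_⟩
    · rintro _ ⟨x, -, rfl⟩
      exact x.2
    · rintro _ ⟨x, hx, rfl⟩ h
      exact Set.disjoint_left.1 hdisj h hx
    · intro y hy
      obtain ⟨x, hx, hle⟩ := ht.isCofinal ⟨y, hy⟩
      exact ⟨x, ⟨x, hx, rfl⟩, hle⟩
    · intro T hT hne hlt
      have hbdd : BddAbove T := ⟨γ, fun x hx => by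
        obtain ⟨i, -, rfl⟩ := hT hx
        exact i.2.le⟩
      refine ⟨⟨sSup T, hlt⟩, ?_, rfl⟩
      refine ht.isLUB_mem (t := {x : Iio γ | (x : Ordinal) ∈ T}) ?_ ?_ ⟨?_, ?_⟩
      · intro x hx
        obtain ⟨x', hx', he⟩ := hT hx
        rwa [← Subtype.ext he]
      · obtain ⟨x, hx⟩ := hne
        obtain ⟨x', hx', rfl⟩ := hT hx
        exact ⟨x', hx⟩
      · exact fun x hx => le_csSup hbdd hx
      · intro b hb
        refine csSup_le hne fun x hx => ?_
        obtain ⟨x', hx', rfl⟩ := hT hx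
        exact hb hx

/-- The intervals between consecutive points of a club cut `[α, γ)` into blocks: `p x` is the first
point of the block of `x`, and `q e` is the end of the block that starts at `e`. -/
theorem exists_blocks {S : Set Ordinal.{u}} {α γ : Ordinal.{u}} (hγ : IsSuccLimit γ)
    (hS : ∀ x ∈ S, IsSuccLimit x) (hstat : ℵ₀ < γ.cof → ¬ StationaryIn S γ) (hα : α ∉ S) :
    ∃ p q : Ordinal.{u} → Ordinal.{u}, ∀ x, α ≤ x → x < γ →
      p x ∉ S ∧ α ≤ p x ∧ p x ≤ x ∧ x < q (p x) ∧ q (p x) < γ ∧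
        ∀ y, p x ≤ y → p x ≤ p y := by
  obtain ⟨E, hEγ, hES, hEcof, hEsup⟩ := exists_club_disjoint hγ hS hstat
  let B : Ordinal.{u} → Set Ordinal.{u} := fun x => {e | (e = α ∨ α < e ∧ e ∈ E) ∧ e ≤ x}
  have hbdd : ∀ x, BddAbove (B x) := fun x => ⟨x, fun e he => he.2⟩
  refine ⟨fun x => sSup (B x), fun e => sInf {z | z ∈ E ∧ e < z}, fun x hαx hxγ => ?_⟩
  have hαB : α ∈ B x := ⟨.inl rfl, hαx⟩
  have hαp : α ≤ sSup (B x) := le_csSup (hbdd x) hαB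
  have hpx : sSup (B x) ≤ x := csSup_le ⟨α, hαB⟩ fun e he => he.2
  have hpB : sSup (B x) ∈ B x := by
    obtain h | h := hαp.eq_or_lt
    · rwa [← h]
    · refine ⟨.inr ⟨h, ?_⟩, hpx⟩
      have hne : (B x \ {α}).Nonempty := by
        obtain ⟨e, he, hlt⟩ := exists_lt_of_lt_csSup ⟨α, hαB⟩ h
        exact ⟨e, he, hlt.ne'⟩
      -- `α` need not lie in `E`, and is dropped to apply the closure of `E`
      have heq : sSup (B x) = sSup (B x \ {α}) := by
        refine le_antisymm (csSup_le ⟨α, hαB⟩ fun e he => ?_)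
          (csSup_le_csSup (hbdd x) hne sdiff_subset)
        have hb : BddAbove (B x \ {α}) := (hbdd x).mono sdiff_subset
        by_cases hea : e = α
        · obtain ⟨e', he'⟩ := hne
          subst hea
          refine le_trans ?_ (le_csSup hb he')
          rcases he'.1.1 with h' | h'
          · exact h'.ge
          · exact h'.1.le
        · exact le_csSup hb ⟨he, hea⟩
      rw [heq]
      refine hEsup _ (fun e he => ?_) hne (heq ▸ hpx.trans_lt hxγ)
      exact (he.1.1.resolve_left he.2).2
  have hqne : {z | z ∈ E ∧ sSup (B x) < z}.Nonempty := by
    obtain ⟨z, hz, hle⟩ := hEcof _ (hγ.add_one_lt (hpx.trans_lt hxγ))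
    exact ⟨z, hz, (lt_add_one _).trans_le hle⟩
  have hq := csInf_mem hqne
  refine ⟨?_, hαp, hpx, ?_, hEγ _ hq.1, fun y hy => le_csSup (hbdd y) ⟨hpB.1, hy⟩⟩
  · rcases hpB.1 with h | h
    · exact fun h' => hα (h ▸ h')
    · exact hES _ h.2
  · by_contra! hle
    exact (le_csSup (hbdd x) ⟨.inr ⟨hαp.trans_lt hq.2, hq.1⟩, hle⟩).not_gt hq.2

/-! ### Ladder systems and their graphs -/

/-- A system of ladders on a set `V` of nodes graded by `lev`. The set `N v` is the ladder of `v`;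
it lies on levels below that of `v`, and fewer than `κ` of its members lie below any given level
outside `S` (in particular nodes whose level is outside `S` have short ladders). Every sequence of
length `κ` that climbs to a level `δ ∈ S` is contained in the ladder of some node on level `δ`. -/
structure IsLadderSystem {V : Type u} (S : Set Ordinal.{u}) (κ : Cardinal.{u})
    (lev : V → Ordinal.{u}) (N : V → Set V) : Prop where
  lev_lt : ∀ {v w}, w ∈ N v → lev w < lev v
  mk_lt : ∀ v, ∀ e ∉ S, e ≤ lev v → #{w | w ∈ N v ∧ lev w < e} < κ
  exists_ladder : ∀ δ ∈ S, ∀ f : κ.ord.ToType → V, (∀ i, lev (f i) < δ) →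
    (∀ e < δ, #{i | lev (f i) < e} < κ) → ∃ v, lev v = δ ∧ ∀ i, f i ∈ N v

/-- The graph of a ladder system joins every node to the members of its ladder. -/
def ladderGraph {V : Type u} (N : V → Set V) : SimpleGraph V :=
  SimpleGraph.fromRel fun v w => w ∈ N v

/-- `c` is a proper colouring of the nodes on the levels in `[α, γ)` that takes its colours from the
palette `A` and avoids the set `F v` of forbidden colours at each node `v`. Only edges from a node
down to its ladder are mentioned, since in a ladder system all edges are of this kind. -/
def IsListColoring {V K : Type u} (lev : V → Ordinal.{u}) (N : V → Set V) (α γ : Ordinal.{u})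
    (A : Set K) (F : V → Set K) (c : V → K) : Prop :=
  ∀ v, α ≤ lev v → lev v < γ → c v ∈ A ∧ c v ∉ F v ∧ ∀ w ∈ N v, α ≤ lev w → c v ≠ c w

/-- Since `lam = lam ^ κ`, the nodes can be taken to be the pairs `(δ, i)` with `δ, i < lam`: index
all sequences of nodes of length `κ` by the `i < lam`, and let the ladder of `(δ, i)` be the
range of the `i`-th sequence whenever `δ ∈ S` and this sequence climbs to `δ`. -/
theorem exists_isLadderSystem {lam κ : Cardinal.{u}} (hlam : ℵ₀ ≤ lam) (hκ : 0 < κ)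
    (hpow : lam = lam ^ κ) {S : Set Ordinal.{u}} (hS : ∀ x ∈ S, x < lam.ord) :
    ∃ (V : Type u) (lev : V → Ordinal.{u}) (N : V → Set V), #V = lam ∧ (∀ v, lev v < lam.ord) ∧
      (∀ δ < lam.ord, ∃ v, lev v = δ) ∧ IsLadderSystem S κ lev N := by
  let L := lam.ord.ToType
  have hL : #(L × L) = lam := by
    simp [L, mul_eq_self hlam]
  have hfun : #L = #(κ.ord.ToType → L × L) := by
    rw [← power_def, hL, mk_ord_toType, mk_ord_toType, ← hpow]
  obtain ⟨h⟩ := Cardinal.eq.1 hfun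
  let lev : L × L → Ordinal.{u} := fun v => ToType.toOrd v.1
  have hex : ∀ δ < lam.ord, ∀ i, ∃ v : L × L, lev v = δ ∧ v.2 = i := fun δ hδ i =>
    ⟨(ToType.mk ⟨δ, hδ⟩, i), by simp [lev], rfl⟩
  let N : L × L → Set (L × L) := fun v => {w | lev v ∈ S ∧ (∀ i, lev (h v.2 i) < lev v) ∧
    (∀ e < lev v, #{i | lev (h v.2 i) < e} < κ) ∧ w ∈ range (h v.2)}
  refine ⟨L × L, lev, N, hL, fun v => (ToType.toOrd v.1).2, fun δ hδ => ?_, ⟨?_, ?_, ?_⟩⟩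
  · have : Nonempty L := by
      rw [← mk_ne_zero_iff, mk_ord_toType]
      exact (aleph0_pos.trans_le hlam).ne'
    obtain ⟨v, hv, -⟩ := hex δ hδ (Classical.arbitrary L)
    exact ⟨v, hv⟩
  · rintro v w ⟨-, hlt, -, i, rfl⟩
    exact hlt i
  · intro v e he hev
    by_cases hv : lev v ∈ S ∧ ∀ e < lev v, #{i | lev (h v.2 i) < e} < κ
    · have hlt : e < lev v := hev.lt_of_ne fun h => he (h ▸ hv.1)
      refine lt_of_le_of_lt ?_ (hv.2 e hlt)
      refine (mk_le_mk_of_subset ?_).trans (mk_image_le (f := h v.2))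
      rintro w ⟨⟨-, -, -, i, rfl⟩, hi⟩
      exact ⟨i, hi, rfl⟩
    · rw [mk_eq_zero_iff.2]
      · exact hκ
      · exact ⟨fun w => hv ⟨w.2.1.1, w.2.1.2.2.1⟩⟩
  · intro δ hδ f hlt hf
    obtain ⟨v, rfl, hv⟩ := hex δ (hS δ hδ) (h.symm f)
    have hvf : h v.2 = f := by rw [hv, Equiv.apply_symm_apply]
    refine ⟨v, rfl, fun i => ⟨hδ, ?_, ?_, ?_⟩⟩
    · rwa [hvf]
    · rwa [hvf]
    · rw [hvf]
      exact mem_range_self i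

/-! ### Colouring small subgraphs -/

theorem exists_disjoint_subsets {K : Type u} {κ : Cardinal.{u}} (hκ : ℵ₀ ≤ κ) {A : Set K}
    (hA : #A = κ) : ∃ B ⊆ A, ∃ C ⊆ A, Disjoint B C ∧ #B = κ ∧ #C = κ := by
  have h : #(A ⊕ A) = #A := by
    rw [mk_sum, Cardinal.lift_id, hA, add_eq_self hκ]
  obtain ⟨e⟩ := Cardinal.eq.1 h
  refine ⟨range fun a => (e (.inl a) : K), ?_, range fun a => (e (.inr a) : K), ?_, ?_, ?_, ?_⟩
  · rintro _ ⟨a, rfl⟩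
    exact (e _).2
  · rintro _ ⟨a, rfl⟩
    exact (e _).2
  · rw [Set.disjoint_left]
    rintro _ ⟨a, rfl⟩ ⟨b, hb⟩
    simpa using e.injective (Subtype.ext hb)
  · rw [← hA]
    exact mk_range_eq _ fun a b hab => Sum.inl_injective (e.injective (Subtype.ext hab))
  · rw [← hA]
    exact mk_range_eq _ fun a b hab => Sum.inr_injective (e.injective (Subtype.ext hab))

/-- The chromatic content of nonreflection: above a level `α ∉ S`, every bounded interval of levels
can be coloured from any palette of size `κ`, even when fewer than `κ` colours are forbidden at each
node. The proof is by induction on `γ`. To add a single level `β`, split the palette into two halves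
and colour the levels below `β` with the first half; the nodes on level `β`, whose ladders may see
all of the first half, then take colours from the second. At a limit `γ`, cut `[α, γ)` into blocks
by a club that avoids `S` and colour them successively: since a block starts at a level outside
`S`, its nodes see fewer than `κ` colours on earlier blocks, and these become forbidden. -/
theorem IsLadderSystem.exists_isListColoring {V K : Type u} {S : Set Ordinal.{u}}
    {κ lam : Cardinal.{u}} {lev : V → Ordinal.{u}} {N : V → Set V} (hκ : ℵ₀ ≤ κ)
    (h : IsLadderSystem S κ lev N)
    (hS : ∀ x ∈ S, IsSuccLimit x) (hrefl : ¬ Reflects S lam) (γ : Ordinal.{u}) :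
    γ < lam.ord → ∀ α ≤ γ, α ∉ S → ∀ A : Set K, #A = κ → ∀ F : V → Set K, (∀ v, #(F v) < κ) →
      ∃ c, IsListColoring lev N α γ A F c := by
  induction γ using Ordinal.limitRecOn with
  | zero =>
    intro _ α _ _ A hA F _
    obtain ⟨k⟩ : Nonempty A := mk_ne_zero_iff.1 (hA ▸ (aleph0_pos.trans_le hκ).ne')
    exact ⟨fun _ => k, fun v _ hv => (not_lt_zero hv).elim⟩
  | add_one β ih =>
    intro hβ α hα hαS A hA F hF
    obtain ⟨B, hBA, C, hCA, hBC, hB, hC⟩ := exists_disjoint_subsets hκ hA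
    have hfree : ∀ v, ∃ k ∈ C, k ∉ F v := by
      intro v
      by_contra! hsub
      exact (hC ▸ mk_le_mk_of_subset hsub).not_gt (hF v)
    choose d hdC hdF using hfree
    obtain rfl | hαβ : α = β + 1 ∨ α ≤ β := by
      rwa [← lt_add_one_iff, ← le_iff_eq_or_lt]
    · exact ⟨d, fun v h₁ h₂ => (h₁.not_gt h₂).elim⟩
    obtain ⟨c, hc⟩ := ih ((lt_add_one β).trans hβ) α hαβ hαS B hB F hF
    classical
    refine ⟨fun v => if lev v < β then c v else d v, fun v hv hvβ => ?_⟩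
    by_cases hlt : lev v < β
    · obtain ⟨h₁, h₂, h₃⟩ := hc v hv hlt
      simp only [if_pos hlt]
      refine ⟨hBA h₁, h₂, fun w hw hαw => ?_⟩
      rw [if_pos ((h.lev_lt hw).trans hlt)]
      exact h₃ w hw hαw
    · simp only [if_neg hlt]
      refine ⟨hCA (hdC v), hdF v, fun w hw hαw heq => ?_⟩
      have hwβ : lev w < β := (h.lev_lt hw).trans_le (lt_add_one_iff.1 hvβ)
      rw [if_pos hwβ] at heq
      exact Set.disjoint_left.1 hBC (hc w hαw hwβ).1 (heq ▸ hdC v)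
  | limit γ hγ ih =>
    intro hγlam α hα hαS A hA F hF
    obtain ⟨k₀⟩ : Nonempty A := mk_ne_zero_iff.1 (hA ▸ (aleph0_pos.trans_le hκ).ne')
    obtain ⟨p, q, hpq⟩ := exists_blocks hγ hS
      (fun hcof hst => hrefl ⟨γ, hγlam, hcof, hst⟩) hαS
    -- the conditions on `e` and `F'` are put inside the existential so that `choose` gives a total
    -- function, to be used in a recursion before the conditions are known
    have hext : ∀ (e : Ordinal.{u}) (F' : V → Set K), ∃ c : V → K, e ∉ S → e ≤ q e → q e < γ →
        (∀ v, #(F' v) < κ) → IsListColoring lev N e (q e) A F' c := by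
      intro e F'
      by_cases hyp : e ∉ S ∧ e ≤ q e ∧ q e < γ ∧ ∀ v, #(F' v) < κ
      · obtain ⟨h₁, h₂, h₃, h₄⟩ := hyp
        obtain ⟨c, hc⟩ := ih (q e) h₃ (h₃.trans hγlam) e h₂ h₁ A hA F' h₄
        exact ⟨c, fun _ _ _ _ => hc⟩
      · exact ⟨fun _ => k₀, fun h₁ h₂ h₃ h₄ => (hyp ⟨h₁, h₂, h₃, h₄⟩).elim⟩
    choose ext hext using hext
    -- `forb e g` adds to `F` the colours that the ladders of the block starting at `e` see on the
    -- earlier blocks, where `g e'` is the colouring of the block starting at `e'`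
    let forb : (e : Ordinal.{u}) → ((e' : Ordinal.{u}) → e' < e → V → K) → V → Set K :=
      fun e g v => F v ∪ {k | e ≤ lev v ∧ ∃ w ∈ N v, lev w < e ∧
        ∃ hw : p (lev w) < e, k = g (p (lev w)) hw w}
    have hforb : ∀ e ∉ S, ∀ g v, #(forb e g v) < κ := by
      intro e he g v
      refine (mk_union_le _ _).trans_lt (add_lt_of_lt hκ (hF v) ?_)
      by_cases hev : e ≤ lev v
      · classical
        refine lt_of_le_of_lt ?_ (h.mk_lt v e he hev)
        refine (mk_le_mk_of_subset ?_).trans (mk_image_le (s := {w | w ∈ N v ∧ lev w < e})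
          (f := fun w => if hw : p (lev w) < e then g (p (lev w)) hw w else k₀))
        rintro k ⟨-, w, hw, hwe, hp, rfl⟩
        exact ⟨w, ⟨hw, hwe⟩, by simp only [dif_pos hp]⟩
      · rw [mk_eq_zero_iff.2]
        · exact aleph0_pos.trans_le hκ
        · exact ⟨fun k => hev k.2.1⟩
    let g : Ordinal.{u} → V → K := WellFounded.fix lt_wf fun e g => ext e (forb e g)
    have hg : ∀ e, g e = ext e (forb e fun e' _ => g e') := fun e => WellFounded.fix_eq _ _ _
    have hcol : ∀ x, α ≤ x → x < γ →
        IsListColoring lev N (p x) (q (p x)) A (forb (p x) fun e' _ => g e') (g (p x)) := by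
      intro x hx hxγ
      obtain ⟨h₁, -, h₂, h₃, h₄, -⟩ := hpq x hx hxγ
      rw [hg]
      exact hext _ _ h₁ (h₂.trans h₃.le) h₄ (hforb _ h₁ fun e' _ => g e')
    refine ⟨fun v => g (p (lev v)) v, fun v hv hvγ => ?_⟩
    obtain ⟨-, -, hpv, hvq, -, hmono⟩ := hpq _ hv hvγ
    obtain ⟨h₁, h₂, h₃⟩ := hcol _ hv hvγ v hpv hvq
    refine ⟨h₁, fun hF => h₂ (.inl hF), fun w hw hαw => ?_⟩
    have hwv := h.lev_lt hw
    obtain ⟨-, -, hpw, hwq, -, hmono'⟩ := hpq _ hαw (hwv.trans hvγ)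
    by_cases hlt : lev w < p (lev v)
    · intro heq
      exact h₂ (.inr ⟨hpv, w, hw, hlt, hpw.trans_lt hlt, heq⟩)
    · have heq : p (lev w) = p (lev v) :=
        (hmono' _ (hpw.trans hwv.le)).antisymm (hmono _ (not_lt.1 hlt))
      change g (p (lev v)) v ≠ g (p (lev w)) w
      rw [heq]
      exact h₃ w hw (not_lt.1 hlt)

theorem ladderGraph_adj {V : Type u} {S : Set Ordinal.{u}} {κ : Cardinal.{u}}
    {lev : V → Ordinal.{u}} {N : V → Set V} (h : IsLadderSystem S κ lev N) {v w : V} :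
    (ladderGraph N).Adj v w ↔ w ∈ N v ∨ v ∈ N w := by
  rw [ladderGraph, SimpleGraph.fromRel_adj, and_iff_right_iff_imp]
  rintro (hw | hw) rfl <;> exact (h.lev_lt hw).false

theorem IsLadderSystem.chromaticCard_coe_le {V : Type u} {S : Set Ordinal.{u}}
    {κ lam : Cardinal.{u}} {lev : V → Ordinal.{u}} {N : V → Set V} (hκ : ℵ₀ ≤ κ)
    (h : IsLadderSystem S κ lev N) (hlam : lam.IsRegular) (hlev : ∀ v, lev v < lam.ord)
    (hS : ∀ x ∈ S, IsSuccLimit x) (hrefl : ¬ Reflects S lam)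
    (H : (ladderGraph N).Subgraph) (hH : #H.verts < lam) : H.coe.chromaticCard ≤ κ := by
  have hγ : (⨆ v : H.verts, lev v + 1) < lam.ord :=
    iSup_add_one_lt_of_lt_cof (by rwa [hlam.cof_ord]) fun v => hlev v
  obtain ⟨c, hc⟩ := h.exists_isListColoring (K := κ.ord.ToType) hκ hS hrefl _ hγ 0 zero_le
    (fun h0 => not_isSuccLimit_bot (hS _ h0)) univ (by simp) (fun _ => ∅)
    (fun _ => by simpa using aleph0_pos.trans_le hκ)
  rw [SimpleGraph.chromaticCard_le_iff]
  have hlt : ∀ v : H.verts, lev v < ⨆ v : H.verts, lev v + 1 := fun v =>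
    (lt_add_one _).trans_le (Ordinal.le_iSup (fun v : H.verts => lev v + 1) v)
  refine ⟨κ.ord.ToType, by simp, ⟨SimpleGraph.Coloring.mk (fun v => c v) ?_⟩⟩
  intro v w hvw
  rcases (ladderGraph_adj h).1 (H.adj_sub hvw) with hw | hw
  · exact (hc v zero_le (hlt v)).2.2 w hw zero_le
  · exact ((hc w zero_le (hlt w)).2.2 v hw zero_le).symm

/-! ### The chromatic number of the whole graph -/

/-- Given a colouring `c` in at most `κ` colours, let `δ ∈ S` be closed under the functions sending
a level to the level of a node above it that has a prescribed colour. Then every colour used on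
level `δ` is used cofinally often below `δ`, so some ladder climbing to `δ` meets all the colours
used on level `δ`, and the node on level `δ` owning this ladder has the colour of a neighbour. -/
theorem IsLadderSystem.lt_chromaticCard {V : Type u} {S : Set Ordinal.{u}}
    {κ lam : Cardinal.{u}} {lev : V → Ordinal.{u}} {N : V → Set V} (hκ : κ.IsRegular)
    (hlam : lam.IsRegular) (hlt : κ < lam)
    (h : IsLadderSystem S κ lev N) (hlev : ∀ v, lev v < lam.ord) (hsurj : ∀ δ ∈ S, ∃ v, lev v = δ)
    (hcof : S ⊆ cofSet lam κ) (hstat : StationaryIn S lam.ord) :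
    κ < (ladderGraph N).chromaticCard := by
  by_contra! hle
  obtain ⟨C, hC, ⟨c⟩⟩ := (SimpleGraph.chromaticCard_le_iff _ _).1 hle
  have hcofI : Order.cof (Iio lam.ord) = Cardinal.lift.{u + 1} lam := by
    rw [cof_Iio, ← lift_cof, hlam.cof_ord]
  have huncount : ℵ₀ < Order.cof (Iio lam.ord) := by
    rw [hcofI, aleph0_lt_lift]
    exact hκ.aleph0_le.trans_lt hlt
  have hIic : ∀ a : Iio lam.ord, #(Iic a) < Order.cof (Iio lam.ord) := by
    intro a
    have h1 : (a : Ordinal) + 1 < lam.ord := (isSuccLimit_ord hlam.aleph0_le).add_one_lt a.2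
    have h2 : #(Iic a) ≤ #(Iio ((a : Ordinal.{u}) + 1)) :=
      mk_le_of_injective (f := fun x : Iic a => (⟨x.1.1, lt_add_one_iff.2 x.2⟩ : Iio _))
        fun x y hxy => Subtype.ext (Subtype.ext (Subtype.mk.inj hxy))
    refine h2.trans_lt ?_
    rw [Cardinal.mk_Iio_ordinal, hcofI, Cardinal.lift_lt]
    exact lt_ord.1 h1
  -- `g ξ y` is the level of some node of colour `ξ` on a level at least `y`, if there is one
  have hg : ∀ (ξ : C) (y : Iio lam.ord), ∃ z : Iio lam.ord, ∀ v, c v = ξ → y ≤ lev v →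
      ∃ w, c w = ξ ∧ y ≤ lev w ∧ lev w = z := by
    intro ξ y
    by_cases hv : ∃ v, c v = ξ ∧ y ≤ lev v
    · obtain ⟨v, hv, hy⟩ := hv
      exact ⟨⟨lev v, hlev v⟩, fun _ _ _ => ⟨v, hv, hy, rfl⟩⟩
    · exact ⟨y, fun v h₁ h₂ => (hv ⟨v, h₁, h₂⟩).elim⟩
  choose g hg using hg
  have hclub : IsClub (⋂ ξ : C, {x | ∀ y < x, g ξ y < x}) := by
    refine IsClub.iInter huncount.ne' ?_
      fun ξ => isClub_setOf_forall_lt_map_lt huncount hIic (g ξ)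
    rw [hcofI, Cardinal.lift_id'.{u, u + 1}, Cardinal.lift_lt.{u, u + 1}]
    exact hC.trans_lt hlt
  obtain ⟨⟨δ, hδlam⟩, hδS, hδE⟩ := hstat hclub
  replace hδS : δ ∈ S := hδS
  rw [mem_iInter] at hδE
  have hclosed : ∀ v, lev v = δ → ∀ y < δ, ∃ w, c w = c v ∧ y ≤ lev w ∧ lev w < δ := by
    intro v hv y hy
    have hylam : y < lam.ord := hy.trans hδlam
    obtain ⟨w, h₁, h₂, h₃⟩ := hg (c v) ⟨y, hylam⟩ v rfl (hv ▸ hy.le)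
    exact ⟨w, h₁, h₂, h₃ ▸ hδE (c v) ⟨y, hylam⟩ hy⟩
  obtain ⟨d, hd, hdlt, hdcof⟩ := exists_strictMono_cofinal (hcof hδS).2
  let B : Set C := c '' {v | lev v = δ}
  have hBne : B.Nonempty := by
    obtain ⟨v, hv⟩ := hsurj δ hδS
    exact ⟨c v, v, hv, rfl⟩
  have hBle : #B ≤ #κ.ord.ToType := by
    rw [mk_ord_toType]
    exact (mk_set_le _).trans hC
  have : Nonempty B := hBne.to_subtype
  obtain ⟨s, hs⟩ : ∃ s : κ.ord.ToType → B, Function.Surjective s := by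
    obtain ⟨e⟩ := hBle
    exact ⟨Function.invFun e, Function.invFun_surjective e.injective⟩
  have hf : ∀ i, ∃ w, c w = s i ∧ d i ≤ lev w ∧ lev w < δ := by
    intro i
    obtain ⟨v, hv, hvs⟩ := (s i).2
    rw [← hvs]
    exact hclosed v hv _ (hdlt i)
  choose f hfc hfd hfδ using hf
  obtain ⟨v, hv, hfv⟩ := h.exists_ladder δ hδS f hfδ fun e he => by
    obtain ⟨i₀, hi₀⟩ := hdcof e he
    refine (mk_le_mk_of_subset fun i hi => ?_).trans_lt (mk_Iio_toType_lt i₀)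
    exact hd.lt_iff_lt.1 ((hfd i).trans_lt (lt_of_lt_of_le hi hi₀))
  obtain ⟨i, hi⟩ := hs ⟨c v, v, hv, rfl⟩
  refine c.valid ((ladderGraph_adj h).2 (.inl (hfv i))) ?_
  rw [hfc, hi]

end Incompactness

theorem claim1p1 (lam κ : Cardinal.{u}) (hlam : lam.IsRegular) (hκ : κ.IsRegular)
    (hlt : κ < lam) (hpow : lam = lam ^ κ)
    (S : Set Ordinal.{u}) (hS : S ⊆ cofSet lam κ) (hstat : StationaryIn S lam.ord)
    (hrefl : ¬ Reflects S lam) :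
    (∃ (V : Type u) (G : SimpleGraph V), #V = lam ∧ κ < G.chromaticCard ∧
      ∀ H : G.Subgraph, #H.verts < lam → H.coe.chromaticCard ≤ κ) ∧
    INCchr lam κ := by
  have hlim : ∀ x ∈ S, Order.IsSuccLimit x := fun x hx =>
    one_lt_cof_iff.1 (aleph0_le_cof_iff.1 ((hS hx).2 ▸ hκ.aleph0_le))
  obtain ⟨V, lev, N, hV, hlev, hsurj, hN⟩ := exists_isLadderSystem hlam.aleph0_le hκ.pos hpow
    fun x hx => (hS hx).1
  have hbig := hN.lt_chromaticCard hκ hlam hlt hlev (fun δ hδ => hsurj δ (hS hδ).1) hS hstat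
  have hsmall := hN.chromaticCard_coe_le hκ.aleph0_le hlam hlev hlim hrefl
  exact ⟨⟨V, ladderGraph N, hV, hbig, hsmall⟩, V, ladderGraph N, hV, Order.succ_le_of_lt hbig,
    fun H hH => Order.lt_succ_of_le (hsmall H hH)⟩
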